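/- Let $\mathcal G=(\mathcal F,\mathcal B,\mathcal E)$ be a finite bipartite graph with no isolated vertices, whose vertices $f\in\mathcal F$ are frontends and $b\in\mathcal B$ are backends. Let $\lambda_f\ge 0$ be the arrival rate at frontend $f$. For each backend $b$ let $\mu_b:[0,\infty)\to\mathbb R$ be a service rate function that is strictly increasing, strictly concave, bounded and twice continuously differentiable with $\mu_b(0)=0$, and put $\mu_b(\infty)=\lim_{n\to\infty}\mu_b(n)$. The arrival rates are arbitrary; in particular the system may be overloaded. For $f\in\mathcal F$ let $\Delta_f$ be the set of $y\in\mathbb R^{\mathcal B}$ with $\sum_{b} y_b=1$, $y_b\ge 0$ if $(f,b)\in\mathcal E$, and $y_b=0$ if $(f,b)\notin\mathcal E$. For $\mathbf N\in\mathbb R_{\ge 0}^{\mathcal B}$ let $$X_f(\mathbf N)=\operatorname*{arg\,max}_{y\in\Delta_f}\ \sum_{b:(f,b)\in\mathcal E} y_b\,\mu_b'(N_b)$$ be the routing decisions of the Greatest Marginal Service Rate (GMSR) policy, and let $$H(\mathbf N)=\Big\{v\in\mathbb R^{\mathcal B}: v_b=\sum_{f\in\mathcal F}\lambda_f x_{f,b}-\mu_b(N_b)\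 \forall b,\ \text{ with } x_f\in X_f(\mathbf N)\ \forall f\Big\}.$$ A GMSR trajectory is a locally absolutely continuous $\mathbf N:[0,\infty)\to\mathbb R_{\ge 0}^{\mathcal B}$, with arbitrary initial state $\mathbf N(0)\in\mathbb R_{\ge0}^{\mathcal B}$, such that $\dot{\mathbf N}(t)\in H(\mathbf N(t))$ for almost every $t\ge 0$. Consider the throughput-maximization linear program $$\textsf{OPT-TP}=\max_{\mathbf L,\mathbf x}\ \sum_{b\in\mathcal B}L_b\quad\text{s.t.}\quad L_b\le\sum_{f\in\mathcal F}\lambda_f x_{f,b},\quad L_b\le\mu_b(\infty)\quad(b\in\mathcal B),\qquad x_f\in\Delta_f\quad(f\in\mathcal F).$$ Then there is a vector $\mathbf L^*\in\mathbb R^{\mathcal B}$, the same for all initial states and all trajectories, which is (the $\mathbf L$-part of) an optimal solution of this program, such that every GMSR trajectory $\mathbf N(\cdot)$ satisfies $$\lim_{t\to\infty}\mu_b(N_b(t))=L_b^*\qquad\text{for all } b\in\mathcal B.$$ -/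

import Mathlib

open Filter Topology MeasureTheory Set

namespace LoadBalancing

/-- The standing assumption on a service rate function `μ`, as a function of the workload
`n ∈ [0, ∞)`: strictly increasing, strictly concave, bounded, twice continuously differentiable
(one-sidedly at `0`), and `μ 0 = 0`. Values of `μ` at negative arguments play no role. -/
structure IsServiceRate (μ : ℝ → ℝ) : Prop where
  strictMonoOn : StrictMonoOn μ (Ici 0)
  strictConcaveOn : StrictConcaveOn ℝ (Ici 0) μ
  bounded : ∃ C : ℝ, ∀ n : ℝ, 0 ≤ n → |μ n| ≤ C
  contDiffOn : ContDiffOn ℝ 2 μ (Ici 0)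
  map_zero : μ 0 = 0

/-- The maximal service rate `μ(∞) = lim_{n → ∞} μ(n)`. -/
noncomputable def capacity (μ : ℝ → ℝ) : ℝ := limUnder atTop μ

/-- For a service rate function the limit defining `μ(∞)` exists. -/
theorem IsServiceRate.tendsto_capacity {μ : ℝ → ℝ} (h : IsServiceRate μ) :
    Tendsto μ atTop (𝓝 (capacity μ)) := by
  obtain ⟨C, hC⟩ := h.bounded
  have hmono : Monotone (fun n : ℝ => μ (max n 0)) := fun a b hab =>
    h.strictMonoOn.monotoneOn (mem_Ici.2 (le_max_right a 0)) (mem_Ici.2 (le_max_right b 0))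
      (max_le_max hab le_rfl)
  have hbdd : BddAbove (range fun n : ℝ => μ (max n 0)) :=
    ⟨C, by rintro _ ⟨n, rfl⟩; exact (abs_le.1 (hC _ (le_max_right n 0))).2⟩
  have hlim := tendsto_atTop_ciSup hmono hbdd
  refine tendsto_nhds_limUnder ⟨_, hlim.congr' ?_⟩
  filter_upwards [eventually_ge_atTop (0 : ℝ)] with n hn
  rw [max_eq_left hn]

/-- The marginal service rate `μ'(n)` at a workload `n ≥ 0` (the right derivative at `n = 0`). -/
noncomputable def marginalRate (μ : ℝ → ℝ) (n : ℝ) : ℝ := derivWithin μ (Ici 0) n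

variable {F B : Type*} [Fintype F] [Fintype B]

/-- `y : B → ℝ` is an admissible vector of routing proportions for the frontend `f` in the
bipartite graph with edge relation `E`. -/
def IsRouting (E : F → B → Prop) (f : F) (y : B → ℝ) : Prop :=
  ∑ b, y b = 1 ∧ (∀ b, E f b → 0 ≤ y b) ∧ (∀ b, ¬ E f b → y b = 0)

open scoped Classical in
/-- The set `X_f(N)` of greatest-marginal-service-rate routing decisions of the frontend `f` at the
workloads `N`: the admissible `y` that maximize `∑_{b ∈ B(f)} y_b μ_b'(N_b)`. -/
def gmsrRouting (E : F → B → Prop) (μ : B → ℝ → ℝ) (f : F) (N : B → ℝ) : Set (B → ℝ) :=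
  {y | IsRouting E f y ∧ ∀ z, IsRouting E f z →
    ∑ b with E f b, z b * marginalRate (μ b) (N b) ≤
      ∑ b with E f b, y b * marginalRate (μ b) (N b)}

/-- The set-valued right-hand side `H(N)` of the differential inclusion: all drifts
`v_b = ∑_f λ_f x_{f,b} - μ_b(N_b)` with `x_f ∈ X_f(N)` for every frontend `f`. -/
def drift (E : F → B → Prop) (lam : F → ℝ) (μ : B → ℝ → ℝ) (N : B → ℝ) : Set (B → ℝ) :=
  {v | ∃ x : F → B → ℝ, (∀ f, x f ∈ gmsrRouting E μ f N) ∧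
    ∀ b, v b = ∑ f, lam f * x f b - μ b (N b)}

/-- `N` is a fluid trajectory under the greatest-marginal-service-rate policy: a solution on
`[0, ∞)`, with state space the nonnegative orthant, of the differential inclusion `N' ∈ H(N)`;
that is, `N` is absolutely continuous on every `[0, T]` and satisfies the inclusion at almost
every time. Values of `N` at negative times play no role. -/
structure IsGMSRTrajectory (E : F → B → Prop) (lam : F → ℝ) (μ : B → ℝ → ℝ)
    (N : ℝ → B → ℝ) : Prop where
  nonneg : ∀ t, 0 ≤ t → ∀ b, 0 ≤ N t b
  absolutelyContinuous : ∀ T, 0 ≤ T → AbsolutelyContinuousOnInterval N 0 T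
  inclusion : ∀ᵐ t ∂(volume.restrict (Ici (0 : ℝ))),
    ∃ v ∈ drift E lam μ (N t), HasDerivAt N v t

/-- Feasibility of `(L, x)` in the throughput-maximization linear program. -/
structure IsTPFeasible (E : F → B → Prop) (lam : F → ℝ) (μ : B → ℝ → ℝ)
    (L : B → ℝ) (x : F → B → ℝ) : Prop where
  le_inflow : ∀ b, L b ≤ ∑ f, lam f * x f b
  le_capacity : ∀ b, L b ≤ capacity (μ b)
  routing : ∀ f, IsRouting E f (x f)

/-- `L` is (the service-rate part of) an optimal solution of the throughput-maximization linear
program: maximize `∑_b L_b` over all feasible `(L, x)`. -/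
def IsTPOptimal (E : F → B → Prop) (lam : F → ℝ) (μ : B → ℝ → ℝ) (L : B → ℝ) : Prop :=
  ∃ x, IsTPFeasible E lam μ L x ∧
    ∀ L' x', IsTPFeasible E lam μ L' x' → ∑ b, L' b ≤ ∑ b, L b

end LoadBalancing

/-! The proof rests on an `ℓ¹` contraction. Let `S` be the set of backends where one workload vector
exceeds another. Since marginal rates strictly decrease, the higher state sends no more inflow to
`S` than the lower one (`sum_inflow_le_of_mem_gmsrRouting`), so the arrival terms never increase the
distance. What remains is dissipation: the distance of two trajectories falls at rate at least `∑ b,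
|μ b (N b) - μ b (M b)|` (`sum_drift_le`, `abs_integral_rate_sub_le`).

Comparing a trajectory with its own time shifts makes its service rates converge, although workloads
may diverge under overload (`exists_tendsto_rate`). Comparing two trajectories forces equal limits,
since a persistent gap would use up more than the initial distance (`limit_rate_le`).

The limit `L` is feasible because time averages of inflows stay in the compact convex set of
admissible inflows and eventually dominate `L` up to any error. It is optimal by a cut argument:
unsaturated backends keep bounded workloads, so their marginal rates stay away from zero, while
those of saturated backends vanish. Frontends adjacent to an unsaturated backend thus eventually use
only such backends, and bounded workloads force these to serve all that traffic (`sum_lam_le`). -/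

namespace LoadBalancing

/-! ### Absolutely continuous functions and a convergence criterion -/

/-- Absolute continuity passes to functions with smaller increments. -/
theorem absolutelyContinuousOnInterval_of_dist_le {X Y : Type*} [PseudoMetricSpace X]
    [PseudoMetricSpace Y] {f : ℝ → X} {g : ℝ → Y} {a b : ℝ}
    (hf : AbsolutelyContinuousOnInterval f a b)
    (h : ∀ x ∈ uIcc a b, ∀ y ∈ uIcc a b, dist (g x) (g y) ≤ dist (f x) (f y)) :
    AbsolutelyContinuousOnInterval g a b := by
  rw [absolutelyContinuousOnInterval_iff] at hf ⊢
  intro ε hε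
  obtain ⟨δ, hδ, H⟩ := hf ε hε
  refine ⟨δ, hδ, fun I hI hlt => (Finset.sum_le_sum fun i hi => ?_).trans_lt (H I hI hlt)⟩
  exact h _ (hI.1 i hi).1 _ (hI.1 i hi).2

theorem absolutelyContinuousOnInterval_sum {ι : Type*} (s : Finset ι) {f : ι → ℝ → ℝ} {a b : ℝ}
    (hf : ∀ i ∈ s, AbsolutelyContinuousOnInterval (f i) a b) :
    AbsolutelyContinuousOnInterval (fun t => ∑ i ∈ s, f i t) a b := by
  classical
  induction s using Finset.induction_on with
  | empty =>
    rw [absolutelyContinuousOnInterval_iff]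
    exact fun ε hε => ⟨1, one_pos, fun I _ _ => by simpa using hε⟩
  | insert i s his ih =>
    simp_rw [Finset.sum_insert his]
    exact (hf i (Finset.mem_insert_self i s)).fun_add
      (ih fun j hj => hf j (Finset.mem_insert_of_mem hj))

/-- An absolutely continuous function whose derivative is almost everywhere at most `φ` grows by
at most the integral of `φ`. -/
theorem sub_le_integral_of_hasDerivAt_le {f φ : ℝ → ℝ} {a b : ℝ} (hab : a ≤ b)
    (hf : AbsolutelyContinuousOnInterval f a b) (hφ : IntervalIntegrable φ volume a b)
    (h : ∀ᵐ t, t ∈ Icc a b → ∀ v, HasDerivAt f v t → v ≤ φ t) :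
    f b - f a ≤ ∫ t in a..b, φ t := by
  rw [← hf.integral_deriv_eq_sub]
  refine intervalIntegral.integral_mono_ae_restrict hab hf.intervalIntegrable_deriv hφ ?_
  rw [EventuallyLE, ae_restrict_iff' measurableSet_Icc]
  filter_upwards [h, hf.ae_differentiableAt] with t h1 h2 ht
  exact h1 ht _ (h2 (by rwa [uIcc_of_le hab])).hasDerivAt

theorem integral_le_sub_of_le_hasDerivAt {f φ : ℝ → ℝ} {a b : ℝ} (hab : a ≤ b)
    (hf : AbsolutelyContinuousOnInterval f a b) (hφ : IntervalIntegrable φ volume a b)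
    (h : ∀ᵐ t, t ∈ Icc a b → ∀ v, HasDerivAt f v t → φ t ≤ v) :
    ∫ t in a..b, φ t ≤ f b - f a := by
  have := sub_le_integral_of_hasDerivAt_le hab hf.fun_neg hφ.neg (by
    filter_upwards [h] with t ht htm v hv
    have hv' : HasDerivAt f (-v) t := by simpa using hv.fun_neg
    have := ht htm _ hv'
    simp only [Pi.neg_apply]
    linarith)
  simp only [Pi.neg_apply, intervalIntegral.integral_neg] at this
  linarith

/-- The derivative of `|f|`, where both `f` and `|f|` are differentiable. -/
theorem hasDerivAt_abs_comp_eq {f : ℝ → ℝ} {v w t : ℝ} (hf : HasDerivAt f v t)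
    (h : HasDerivAt (fun u => |f u|) w t) :
    w = (if 0 < f t then v else 0) + (if f t < 0 then -v else 0) := by
  rcases lt_trichotomy (f t) 0 with h0 | h0 | h0
  · rw [if_neg h0.not_gt, if_pos h0, zero_add]
    refine (h.congr_of_eventuallyEq ?_).unique hf.neg
    filter_upwards [hf.continuousAt.eventually (gt_mem_nhds h0)] with u hu
    simp [abs_of_neg hu]
  · simp only [h0, lt_irrefl, if_false, add_zero]
    -- At a zero of `f`, `|f|` attains its minimum, so its derivative can only be zero.
    refine IsLocalMin.hasDerivAt_eq_zero (Eventually.of_forall fun u => ?_) h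
    simp [h0]
  · rw [if_pos h0, if_neg h0.not_gt, add_zero]
    refine (h.congr_of_eventuallyEq ?_).unique hf
    filter_upwards [hf.continuousAt.eventually (lt_mem_nhds h0)] with u hu
    simp [abs_of_pos hu]

/-- A Lipschitz function `g` on `[0, ∞)` converges if the integrals of its increments
`g (u + h) - g u` are controlled by the decrease of a nonnegative function, for each `h > 0`. -/
theorem exists_tendsto_of_integral_shift_le {g : ℝ → ℝ} {K : ℝ} (hK : 0 ≤ K)
    (hg : ∀ s t, 0 ≤ s → s ≤ t → |g t - g s| ≤ K * (t - s)) (hgc : ContinuousOn g (Ici 0))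
    (hφ : ∀ h, 0 < h → ∃ φ : ℝ → ℝ, (∀ t, 0 ≤ φ t) ∧ ∀ s t, 0 ≤ s → s ≤ t →
      |∫ u in s..t, (g (u + h) - g u)| ≤ φ s - φ t) :
    ∃ l, Tendsto g atTop (𝓝 l) := by
  have hint : ∀ s t, 0 ≤ s → 0 ≤ t → IntervalIntegrable g volume s t := fun s t hs ht =>
    (hgc.mono fun u hu => (le_min hs ht).trans hu.1).intervalIntegrable
  refine cauchySeq_tendsto_of_complete (Metric.cauchySeq_iff'.2 fun ε hε => ?_)
  -- With this window length, replacing `g` on `[s, s + h]` by `g s` costs at most `h * (ε / 4)` in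
  -- the integral.
  set h : ℝ := ε / (4 * (K + 1)) with hh
  have hpos : 0 < h := by positivity
  have hKh : K * h ≤ ε / 4 := by
    rw [hh, mul_div_assoc', div_le_div_iff₀ (by positivity) (by positivity)]
    nlinarith
  obtain ⟨φ, hφ0, hφ1⟩ := hφ h hpos
  have hbdd : BddBelow (φ '' Ici 0) := ⟨0, by rintro _ ⟨t, -, rfl⟩; exact hφ0 t⟩
  have hne : (φ '' Ici (0 : ℝ)).Nonempty := ⟨_, 0, self_mem_Ici, rfl⟩
  -- Near the infimum of `φ` on `[0, ∞)`, no later time can lower `φ` by more than `h * (ε / 4)`.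
  obtain ⟨_, ⟨T, hT, rfl⟩, hTlt⟩ := exists_lt_of_csInf_lt hne
    (lt_add_of_pos_right (sInf (φ '' Ici 0)) (by positivity : 0 < h * (ε / 4)))
  have hT : 0 ≤ T := hT
  refine ⟨T, fun t ht => ?_⟩
  have ht : T ≤ t := ht
  have ht0 : 0 ≤ t := hT.trans ht
  have h1 : |∫ u in T..t, (g (u + h) - g u)| ≤ h * (ε / 4) := by
    refine (hφ1 T t hT ht).trans ?_
    have : sInf (φ '' Ici 0) ≤ φ t := csInf_le hbdd ⟨t, ht0, rfl⟩
    linarith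
  have hshift : IntervalIntegrable (fun u => g (u + h)) volume T t := by
    refine ContinuousOn.intervalIntegrable ?_
    rw [uIcc_of_le ht]
    refine hgc.comp (by fun_prop) fun u hu => ?_
    have := hu.1
    simp only [mem_Ici]
    linarith
  -- The overlap cancels and leaves the two end windows.
  have h2 : ∫ u in T..t, (g (u + h) - g u) =
      (∫ u in t..t + h, g u) - ∫ u in T..T + h, g u := by
    rw [intervalIntegral.integral_sub hshift (hint _ _ hT ht0),
      intervalIntegral.integral_comp_add_right,
      intervalIntegral.integral_interval_sub_interval_comm (hint _ _ (by linarith) (by linarith))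
        (hint _ _ hT ht0) (hint _ _ (by linarith) hT)]
    rw [intervalIntegral.integral_symm t, intervalIntegral.integral_symm T]
    ring
  have h3 : ∀ s, 0 ≤ s → |(∫ u in s..s + h, g u) - h * g s| ≤ K * h * h := by
    intro s hs
    have : (∫ u in s..s + h, g u) - h * g s = ∫ u in s..s + h, (g u - g s) := by
      rw [intervalIntegral.integral_sub (hint _ _ hs (by linarith)) (by simp)]
      simp
    rw [this]
    have := intervalIntegral.norm_integral_le_of_norm_le_const (a := s) (b := s + h)
      (f := fun u => g u - g s) (C := K * h) fun u hu => by
        rw [uIoc_of_le (by linarith)] at hu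
        refine (hg s u hs hu.1.le).trans ?_
        have := hu.2
        gcongr
        linarith
    simpa [abs_of_pos hpos] using this
  have h4 := h3 t ht0
  have h5 := h3 T hT
  rw [h2] at h1
  -- Two window errors and the shift integral contribute `h * (ε / 4)` each.
  have h6 : h * |g t - g T| < h * ε := by
    rw [← abs_of_pos hpos, ← abs_mul, abs_of_pos hpos, abs_lt]
    have h7 : K * h * h ≤ ε / 4 * h := by gcongr
    have h8 : 0 < h * ε := by positivity
    rw [abs_le] at h1 h4 h5
    constructor <;> nlinarith
  exact lt_of_mul_lt_mul_left h6 hpos.le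

/-! ### Service rate functions -/

namespace IsServiceRate

variable {μ : ℝ → ℝ}

theorem differentiableOn (h : IsServiceRate μ) : DifferentiableOn ℝ μ (Ici 0) :=
  h.contDiffOn.differentiableOn (by norm_num)

theorem strictAntiOn_marginalRate (h : IsServiceRate μ) : StrictAntiOn (marginalRate μ) (Ici 0) :=
  h.strictConcaveOn.strictAntiOn_derivWithin h.differentiableOn

theorem marginalRate_nonneg (h : IsServiceRate μ) (n : ℝ) : 0 ≤ marginalRate μ n :=
  h.strictMonoOn.monotoneOn.derivWithin_nonneg

theorem marginalRate_pos (h : IsServiceRate μ) {n : ℝ} (hn : 0 ≤ n) : 0 < marginalRate μ n :=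
  (h.marginalRate_nonneg (n + 1)).trans_lt
    (h.strictAntiOn_marginalRate hn (mem_Ici.2 (by linarith)) (by linarith))

theorem abs_sub_le (h : IsServiceRate μ) {m n : ℝ} (hm : 0 ≤ m) (hn : 0 ≤ n) :
    |μ n - μ m| ≤ marginalRate μ 0 * |n - m| := by
  have := (convex_Ici (0 : ℝ)).norm_image_sub_le_of_norm_derivWithin_le (f := μ)
    (C := marginalRate μ 0) h.differentiableOn (fun x hx => ?_) hm hn
  · exact this
  · refine (Real.norm_of_nonneg (h.marginalRate_nonneg x)).le.trans ?_
    exact h.strictAntiOn_marginalRate.antitoneOn self_mem_Ici hx hx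

/-- By concavity the chord from the origin is at least as steep as the tangent at `n`. As `μ` is
bounded, this makes the marginal rate vanish at infinity. -/
theorem mul_marginalRate_le (h : IsServiceRate μ) {n : ℝ} (hn : 0 < n) : n * marginalRate μ n ≤ μ n := by
  have := h.strictConcaveOn.concaveOn.derivWithin_le_slope self_mem_Ici hn.le hn
    (h.differentiableOn n hn.le)
  rw [slope_def_field, h.map_zero, sub_zero, sub_zero, le_div_iff₀ hn] at this
  rw [mul_comm]
  exact this

theorem le_capacity (h : IsServiceRate μ) {n : ℝ} (hn : 0 ≤ n) : μ n ≤ capacity μ := by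
  refine ge_of_tendsto h.tendsto_capacity ?_
  filter_upwards [eventually_ge_atTop n] with m hm
  exact h.strictMonoOn.monotoneOn hn (hn.trans hm) hm

theorem lt_capacity (h : IsServiceRate μ) {n : ℝ} (hn : 0 ≤ n) : μ n < capacity μ :=
  (h.strictMonoOn hn (mem_Ici.2 (by linarith)) (lt_add_one n)).trans_le
    (h.le_capacity (by linarith))

theorem nonneg (h : IsServiceRate μ) {n : ℝ} (hn : 0 ≤ n) : 0 ≤ μ n := by
  rw [← h.map_zero]
  exact h.strictMonoOn.monotoneOn self_mem_Ici hn hn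

theorem tendsto_marginalRate (h : IsServiceRate μ) : Tendsto (marginalRate μ) atTop (𝓝 0) := by
  refine squeeze_zero' (Eventually.of_forall h.marginalRate_nonneg) ?_
    (tendsto_const_nhds.div_atTop tendsto_id : Tendsto (fun n : ℝ => capacity μ / n) atTop (𝓝 0))
  filter_upwards [eventually_gt_atTop (0 : ℝ)] with n hn
  rw [le_div_iff₀ hn, mul_comm]
  exact (h.mul_marginalRate_le hn).trans (h.le_capacity hn.le)

end IsServiceRate

end LoadBalancing

/-! ### Routing decisions and their monotonicity -/

namespace LoadBalancing

variable {F B : Type*} [Fintype B] {E : F → B → Prop} {lam : F → ℝ} {μ : B → ℝ → ℝ} {f : F}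

theorem IsRouting.nonneg {y : B → ℝ} (hy : IsRouting E f y) (b : B) : 0 ≤ y b := by
  by_cases h : E f b
  · exact hy.2.1 b h
  · exact (hy.2.2 b h).ge

theorem isRouting_iff {y : B → ℝ} :
    IsRouting E f y ↔ y ∈ stdSimplex ℝ B ∧ ∀ b, ¬ E f b → y b = 0 :=
  ⟨fun h => ⟨⟨h.nonneg, h.1⟩, h.2.2⟩, fun h => ⟨h.1.2, fun b _ => h.1.1 b, h.2⟩⟩

theorem convex_isRouting (E : F → B → Prop) (f : F) : Convex ℝ {y : B → ℝ | IsRouting E f y} := by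
  intro y hy z hz a b ha hb hab
  refine isRouting_iff.2 ⟨convex_stdSimplex ℝ B (isRouting_iff.1 hy).1 (isRouting_iff.1 hz).1
    ha hb hab, fun c hc => ?_⟩
  simp [hy.2.2 c hc, hz.2.2 c hc]

theorem isCompact_isRouting (E : F → B → Prop) (f : F) :
    IsCompact {y : B → ℝ | IsRouting E f y} := by
  have : {y : B → ℝ | IsRouting E f y} = stdSimplex ℝ B ∩ {y | ∀ b, ¬ E f b → y b = 0} := by
    ext y
    exact isRouting_iff
  rw [this]
  refine (isCompact_stdSimplex ℝ B).inter_right ?_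
  simp only [ofPred_forall]
  exact isClosed_iInter fun b => isClosed_iInter fun _ =>
    isClosed_eq (continuous_apply b) continuous_const

open scoped Classical in
theorem exists_isRouting {b : B} (h : E f b) : IsRouting E f (Pi.single b 1) :=
  isRouting_iff.2 ⟨single_mem_stdSimplex ℝ b, fun c hc =>
    Pi.single_eq_of_ne (by rintro rfl; exact hc h) 1⟩

/-- A greatest-marginal-service-rate decision only uses backends of greatest marginal rate. -/
theorem marginalRate_le_of_mem_gmsrRouting {N y : B → ℝ} (hy : y ∈ gmsrRouting E μ f N) {b c : B}
    (hb : 0 < y b) (hc : E f c) :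
    marginalRate (μ c) (N c) ≤ marginalRate (μ b) (N b) := by
  classical
  have hEb : E f b := by
    by_contra h
    exact hb.ne' (hy.1.2.2 b h)
  rcases eq_or_ne c b with rfl | hcb
  · exact le_rfl
  -- Exchange argument: move all the mass at `b` to `c`.
  set z : B → ℝ := fun d => y d + y b * ((if d = c then 1 else 0) - (if d = b then 1 else 0))
  have hz : IsRouting E f z := by
    refine ⟨?_, fun d hd => ?_, fun d hd => ?_⟩
    · simp [z, Finset.sum_add_distrib, ← Finset.mul_sum, Finset.sum_sub_distrib, hy.1.1]
    · have := hy.1.nonneg d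
      rcases eq_or_ne d b with rfl | hdb
      · simp [z, hcb.symm]
      · simp only [z, if_neg hdb, sub_zero]
        split_ifs <;> linarith
    · have h1 : d ≠ c := fun h => hd (h ▸ hc)
      have h2 : d ≠ b := fun h => hd (h ▸ hEb)
      simp [z, h1, h2, hy.1.2.2 d hd]
  have := hy.2 z hz
  simp only [z, add_mul, Finset.sum_add_distrib, mul_assoc, ← Finset.mul_sum, sub_mul,
    Finset.sum_sub_distrib, ite_mul, one_mul, zero_mul, Finset.sum_ite_eq',
    Finset.mem_filter, Finset.mem_univ, true_and, hc, hEb, if_true] at this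
  nlinarith

/-- Raising the workloads of the backends in `S` and lowering the others does not increase the
proportion that a frontend sends to `S`. -/
theorem sum_routing_le_of_mem_gmsrRouting (hμ : ∀ b, IsServiceRate (μ b)) {n m x y : B → ℝ}
    (hn : ∀ b, 0 ≤ n b) (hm : ∀ b, 0 ≤ m b)
    (hx : x ∈ gmsrRouting E μ f n) (hy : y ∈ gmsrRouting E μ f m) :
    ∑ b with m b < n b, x b ≤ ∑ b with m b < n b, y b := by
  by_cases h : ∃ c, ¬ m c < n c ∧ 0 < y c
  · obtain ⟨c, hc, hyc⟩ := h
    have hEc : E f c := by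
      by_contra h
      exact hyc.ne' (hy.1.2.2 c h)
    refine Finset.sum_le_sum fun b hb => ?_
    have hb : m b < n b := (Finset.mem_filter.1 hb).2
    -- If `x` used `b`, the marginal rates would satisfy the cycle `b` at `n` < `b` at `m` ≤ `c` at
    -- `m` ≤ `c` at `n` ≤ `b` at `n`.
    refine le_trans (le_of_not_gt fun hxb => ?_) (hy.1.nonneg b)
    have hEb : E f b := by
      by_contra h
      exact hxb.ne' (hx.1.2.2 b h)
    have h1 := marginalRate_le_of_mem_gmsrRouting hx hxb hEc
    have h2 := marginalRate_le_of_mem_gmsrRouting hy hyc hEb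
    have h3 := (hμ b).strictAntiOn_marginalRate (hm b) (hn b) hb
    have h4 := (hμ c).strictAntiOn_marginalRate.antitoneOn (hn c) (hm c) (not_lt.1 hc)
    linarith
  -- Here `y` puts all its mass on the raised backends, so the right side is already `1`.
  · push Not at h
    have h1 : ∑ b with m b < n b, y b = 1 := by
      rw [← hy.1.1]
      exact Finset.sum_filter_of_ne fun b _ hb => by
        by_contra hlt
        exact hb ((h b (not_lt.1 hlt)).antisymm (hy.1.nonneg b))
    rw [h1, ← hx.1.1]
    exact Finset.sum_le_univ_sum_of_nonneg hx.1.nonneg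

/-! ### Inflows and dissipation of the `ℓ¹` distance -/

variable [Fintype F]

/-- The vectors of total arrival rates at the backends that admissible routing can produce. -/
def inflows (E : F → B → Prop) (lam : F → ℝ) : Set (B → ℝ) :=
  {w | ∃ x : F → B → ℝ, (∀ f, IsRouting E f (x f)) ∧ ∀ b, w b = ∑ f, lam f * x f b}

theorem inflows_eq_image (E : F → B → Prop) (lam : F → ℝ) :
    inflows E lam = (fun (x : F → B → ℝ) b => ∑ f, lam f * x f b) ''
      univ.pi fun f => {y | IsRouting E f y} := by
  ext w
  simp only [inflows, mem_ofPred_eq, mem_image, mem_univ_pi, funext_iff, eq_comm]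

theorem isCompact_inflows (E : F → B → Prop) (lam : F → ℝ) : IsCompact (inflows E lam) := by
  rw [inflows_eq_image]
  exact (isCompact_univ_pi fun f => isCompact_isRouting E f).image (by fun_prop)

theorem convex_inflows (E : F → B → Prop) (lam : F → ℝ) : Convex ℝ (inflows E lam) := by
  rintro w ⟨x, hx, hw⟩ w' ⟨x', hx', hw'⟩ a b ha hb hab
  refine ⟨fun f => a • x f + b • x' f, fun f => convex_isRouting E f (hx f) (hx' f) ha hb hab,
    fun c => ?_⟩
  simp only [Pi.add_apply, Pi.smul_apply, smul_eq_mul, hw, hw', Finset.mul_sum,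
    ← Finset.sum_add_distrib]
  exact Finset.sum_congr rfl fun f _ => by ring

theorem inflows_nonempty (hF : ∀ f, ∃ b, E f b) (lam : F → ℝ) : (inflows E lam).Nonempty := by
  classical
  choose b hb using hF
  exact ⟨_, fun f => Pi.single (b f) 1, fun f => exists_isRouting (hb f), fun _ => rfl⟩

theorem nonneg_of_mem_inflows (hlam : ∀ f, 0 ≤ lam f) {w : B → ℝ} (hw : w ∈ inflows E lam)
    (b : B) : 0 ≤ w b := by
  obtain ⟨x, hx, hw⟩ := hw
  rw [hw]
  exact Finset.sum_nonneg fun f _ => mul_nonneg (hlam f) ((hx f).nonneg b)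

theorem sum_eq_of_mem_inflows {w : B → ℝ} (hw : w ∈ inflows E lam) :
    ∑ b, w b = ∑ f, lam f := by
  obtain ⟨x, hx, hw⟩ := hw
  simp_rw [hw]
  rw [Finset.sum_comm]
  simp_rw [← Finset.mul_sum, (hx _).1, mul_one]

theorem le_of_mem_inflows (hlam : ∀ f, 0 ≤ lam f) {w : B → ℝ} (hw : w ∈ inflows E lam) (b : B) :
    w b ≤ ∑ f, lam f := by
  rw [← sum_eq_of_mem_inflows hw]
  exact Finset.single_le_sum (fun c _ => nonneg_of_mem_inflows hlam hw c) (Finset.mem_univ b)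

/-- Raising the workloads of the backends in `S` and lowering the others does not increase the
total arrival rate at `S`. -/
theorem sum_inflow_le_of_mem_gmsrRouting (hlam : ∀ f, 0 ≤ lam f)
    (hμ : ∀ b, IsServiceRate (μ b)) {n m : B → ℝ} {x y : F → B → ℝ}
    (hn : ∀ b, 0 ≤ n b) (hm : ∀ b, 0 ≤ m b)
    (hx : ∀ f, x f ∈ gmsrRouting E μ f n) (hy : ∀ f, y f ∈ gmsrRouting E μ f m) :
    ∑ b with m b < n b, ∑ f, lam f * x f b ≤ ∑ b with m b < n b, ∑ f, lam f * y f b := by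
  rw [Finset.sum_comm, Finset.sum_comm (s := Finset.univ.filter _)]
  simp_rw [← Finset.mul_sum]
  exact Finset.sum_le_sum fun f _ =>
    mul_le_mul_of_nonneg_left (sum_routing_le_of_mem_gmsrRouting hμ hn hm (hx f) (hy f)) (hlam f)

/-- The `ℓ¹` distance of two workload vectors decreases at least at the rate of the
total difference of their service rates. -/
theorem sum_drift_le (hlam : ∀ f, 0 ≤ lam f) (hμ : ∀ b, IsServiceRate (μ b)) {n m v v' : B → ℝ}
    (hn : ∀ b, 0 ≤ n b) (hm : ∀ b, 0 ≤ m b)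
    (hv : v ∈ drift E lam μ n) (hv' : v' ∈ drift E lam μ m) :
    ∑ b, ((if 0 < n b - m b then v b - v' b else 0) +
      (if n b - m b < 0 then -(v b - v' b) else 0)) ≤ -∑ b, |μ b (n b) - μ b (m b)| := by
  obtain ⟨x, hx, hv⟩ := hv
  obtain ⟨y, hy, hv'⟩ := hv'
  have h1 := sum_inflow_le_of_mem_gmsrRouting hlam hμ hn hm hx hy
  have h2 := sum_inflow_le_of_mem_gmsrRouting hlam hμ hm hn hy hx
  rw [Finset.sum_filter, Finset.sum_filter] at h1 h2
  have key : ∀ b, ((if 0 < n b - m b then v b - v' b else 0) +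
      (if n b - m b < 0 then -(v b - v' b) else 0)) =
      ((if m b < n b then ∑ f, lam f * x f b else 0) -
        (if m b < n b then ∑ f, lam f * y f b else 0)) +
      ((if n b < m b then ∑ f, lam f * y f b else 0) -
        (if n b < m b then ∑ f, lam f * x f b else 0)) - |μ b (n b) - μ b (m b)| := by
    intro b
    rw [hv, hv']
    rcases lt_trichotomy (n b) (m b) with h | h | h
    · have := (hμ b).strictMonoOn (hn b) (hm b) h
      simp only [sub_pos, sub_neg, h, h.not_gt, if_true, if_false, abs_of_neg (sub_neg.2 this)]
      ring
    · simp [h]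
    · have := (hμ b).strictMonoOn (hm b) (hn b) h
      simp only [sub_pos, sub_neg, h, h.not_gt, if_true, if_false, abs_of_pos (sub_pos.2 this)]
      ring
  simp_rw [key, Finset.sum_sub_distrib, Finset.sum_add_distrib, Finset.sum_sub_distrib]
  linarith

/-! ### Contraction of trajectories and convergence of service rates -/

namespace IsGMSRTrajectory

variable {N M : ℝ → B → ℝ}

theorem ae_hasDerivAt (h : IsGMSRTrajectory E lam μ N) :
    ∀ᵐ t, 0 ≤ t → ∃ v ∈ drift E lam μ (N t), ∀ b, HasDerivAt (fun u => N u b) (v b) t := by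
  have := h.inclusion
  rw [ae_restrict_iff' measurableSet_Ici] at this
  filter_upwards [this] with t ht h0
  obtain ⟨v, hv, hd⟩ := ht h0
  exact ⟨v, hv, hasDerivAt_pi.1 hd⟩

theorem absolutelyContinuousOnInterval (h : IsGMSRTrajectory E lam μ N) {s t : ℝ} (hs : 0 ≤ s)
    (ht : 0 ≤ t) : AbsolutelyContinuousOnInterval N s t := by
  refine (h.absolutelyContinuous (max s t) (hs.trans (le_max_left _ _))).mono ?_
  rw [uIcc_of_le (hs.trans (le_max_left s t))]
  exact fun u hu => ⟨(le_min hs ht).trans hu.1, hu.2⟩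

theorem absolutelyContinuousOnInterval_apply (h : IsGMSRTrajectory E lam μ N) {s t : ℝ}
    (hs : 0 ≤ s) (ht : 0 ≤ t) (b : B) : AbsolutelyContinuousOnInterval (fun u => N u b) s t :=
  absolutelyContinuousOnInterval_of_dist_le (h.absolutelyContinuousOnInterval hs ht)
    fun u _ w _ => dist_le_pi_dist (N u) (N w) b

theorem continuousOn (h : IsGMSRTrajectory E lam μ N) (b : B) :
    ContinuousOn (fun t => N t b) (Ici 0) := by
  intro t ht
  have ht : 0 ≤ t := ht
  have := (h.absolutelyContinuousOnInterval_apply le_rfl (by linarith : 0 ≤ t + 1) b).continuousOn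
    t (by rw [uIcc_of_le (by linarith)]; exact ⟨ht, by linarith⟩)
  refine this.mono_of_mem_nhdsWithin ?_
  rw [uIcc_of_le (by linarith), ← Ici_inter_Iic]
  exact inter_mem_nhdsWithin _ (Iic_mem_nhds (by linarith))

theorem continuousOn_rate (h : IsGMSRTrajectory E lam μ N) (hμ : ∀ b, IsServiceRate (μ b))
    (b : B) : ContinuousOn (fun t => μ b (N t b)) (Ici 0) :=
  (hμ b).differentiableOn.continuousOn.comp (h.continuousOn b) fun t ht => h.nonneg t ht b

theorem intervalIntegrable_rate (h : IsGMSRTrajectory E lam μ N) (hμ : ∀ b, IsServiceRate (μ b))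
    (b : B) {s t : ℝ} (hs : 0 ≤ s) (ht : 0 ≤ t) :
    IntervalIntegrable (fun t => μ b (N t b)) volume s t :=
  ((h.continuousOn_rate hμ b).mono fun _ hu => (le_min hs ht).trans hu.1).intervalIntegrable

/-- A trajectory started at a later time is a trajectory. -/
theorem shift (h : IsGMSRTrajectory E lam μ N) {s : ℝ} (hs : 0 ≤ s) :
    IsGMSRTrajectory E lam μ fun t => N (t + s) where
  nonneg t ht b := h.nonneg _ (by linarith) b
  absolutelyContinuous T hT := by
    have := h.absolutelyContinuousOnInterval hs (by linarith : 0 ≤ T + s)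
    rw [absolutelyContinuousOnInterval_iff] at this ⊢
    intro ε hε
    obtain ⟨δ, hδ, H⟩ := this ε hε
    refine ⟨δ, hδ, fun I hI hlt => ?_⟩
    refine H (I.1, fun i => ((I.2 i).1 + s, (I.2 i).2 + s)) ⟨fun i hi => ?_, ?_⟩ (by simpa using hlt)
    · have h1 := hI.1 i hi
      rw [uIcc_of_le hT] at h1
      rw [uIcc_of_le (by linarith)]
      exact ⟨⟨by linarith [h1.1.1], by linarith [h1.1.2]⟩,
        ⟨by linarith [h1.2.1], by linarith [h1.2.2]⟩⟩
    · intro i hi j hj hij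
      have h2 := hI.2 hi hj hij
      simp only [Function.onFun, Set.disjoint_left, mem_uIoc] at h2 ⊢
      intro u hu hu'
      refine @h2 (u - s) ?_ ?_
      · rcases hu with hu | hu
        · exact Or.inl ⟨by linarith [hu.1], by linarith [hu.2]⟩
        · exact Or.inr ⟨by linarith [hu.1], by linarith [hu.2]⟩
      · rcases hu' with hu | hu
        · exact Or.inl ⟨by linarith [hu.1], by linarith [hu.2]⟩
        · exact Or.inr ⟨by linarith [hu.1], by linarith [hu.2]⟩
  inclusion := by
    have := h.inclusion
    rw [ae_restrict_iff' measurableSet_Ici] at this ⊢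
    have h1 := (measurePreserving_add_right volume s).quasiMeasurePreserving.ae this
    filter_upwards [h1] with t ht h0
    obtain ⟨v, hv, hd⟩ := ht (mem_Ici.2 (add_nonneg h0 hs))
    exact ⟨v, hv, hd.comp_add_const t s⟩

/-- The `ℓ¹` distance of two trajectories decreases, at least at the rate of the
difference of their service rates. -/
theorem abs_integral_rate_sub_le (hlam : ∀ f, 0 ≤ lam f) (hμ : ∀ b, IsServiceRate (μ b))
    (hN : IsGMSRTrajectory E lam μ N) (hM : IsGMSRTrajectory E lam μ M) (b : B) {s t : ℝ}
    (hs : 0 ≤ s) (hst : s ≤ t) :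
    |∫ u in s..t, (μ b (N u b) - μ b (M u b))| ≤
      ∑ b, |N s b - M s b| - ∑ b, |N t b - M t b| := by
  have ht := hs.trans hst
  have hint : ∀ b, IntervalIntegrable (fun u => |μ b (N u b) - μ b (M u b)|) volume s t :=
    fun b => ((hN.intervalIntegrable_rate hμ b hs ht).sub
      (hM.intervalIntegrable_rate hμ b hs ht)).abs
  have hac : ∀ b, AbsolutelyContinuousOnInterval (fun u => |N u b - M u b|) s t := fun b =>
    absolutelyContinuousOnInterval_of_dist_le
      ((hN.absolutelyContinuousOnInterval_apply hs ht b).fun_sub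
        (hM.absolutelyContinuousOnInterval_apply hs ht b)) fun _ _ _ _ => abs_abs_sub_abs_le _ _
  have hmain : ∑ b, |N t b - M t b| - ∑ b, |N s b - M s b| ≤
      ∫ u in s..t, -∑ b, |μ b (N u b) - μ b (M u b)| := by
    refine sub_le_integral_of_hasDerivAt_le (f := fun u => ∑ b, |N u b - M u b|) hst
      (absolutelyContinuousOnInterval_sum _ fun b _ => hac b)
      (IntervalIntegrable.neg (by
        simpa only [Finset.sum_fn] using IntervalIntegrable.sum Finset.univ fun b _ => hint b)) ?_
    have hdiff : ∀ᵐ u, ∀ b, u ∈ uIcc s t → DifferentiableAt ℝ (fun u => |N u b - M u b|) u :=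
      ae_all_iff.2 fun b => (hac b).ae_differentiableAt
    filter_upwards [hN.ae_hasDerivAt, hM.ae_hasDerivAt, hdiff] with u h1 h2 h3 hu w hw
    have hu0 := hs.trans hu.1
    obtain ⟨v, hv, hdN⟩ := h1 hu0
    obtain ⟨v', hv', hdM⟩ := h2 hu0
    refine le_trans (le_of_eq ?_) (sum_drift_le hlam hμ (hN.nonneg u hu0) (hM.nonneg u hu0) hv hv')
    refine hw.unique ?_
    refine HasDerivAt.fun_sum fun b _ => ?_
    have h4 := (h3 b (by rwa [uIcc_of_le hst])).hasDerivAt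
    have h5 := hasDerivAt_abs_comp_eq ((hdN b).fun_sub (hdM b)) h4
    rw [← h5]
    exact h4
  rw [intervalIntegral.integral_neg, intervalIntegral.integral_finsetSum fun b _ => hint b] at hmain
  have h6 : |∫ u in s..t, (μ b (N u b) - μ b (M u b))| ≤
      ∫ u in s..t, |μ b (N u b) - μ b (M u b)| :=
    intervalIntegral.abs_integral_le_integral_abs hst
  have h7 : ∫ u in s..t, |μ b (N u b) - μ b (M u b)| ≤
      ∑ b, ∫ u in s..t, |μ b (N u b) - μ b (M u b)| :=
    Finset.single_le_sum (f := fun b => ∫ u in s..t, |μ b (N u b) - μ b (M u b)|)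
      (fun b _ => intervalIntegral.integral_nonneg hst fun _ _ => abs_nonneg _)
      (Finset.mem_univ b)
  linarith

/-- Inflow lies between `0` and `∑ f, lam f`, and service between `0` and the capacity. This
supplies the Lipschitz bound required by the convergence criterion. -/
theorem abs_sub_le (hlam : ∀ f, 0 ≤ lam f) (hμ : ∀ b, IsServiceRate (μ b))
    (h : IsGMSRTrajectory E lam μ N) (b : B) {s t : ℝ} (hs : 0 ≤ s) (hst : s ≤ t) :
    |N t b - N s b| ≤ (∑ f, lam f + capacity (μ b)) * (t - s) := by
  have ht := hs.trans hst
  have hac := h.absolutelyContinuousOnInterval_apply hs ht b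
  have hΛ : 0 ≤ ∑ f, lam f := Finset.sum_nonneg fun f _ => hlam f
  have hd : ∀ᵐ u, u ∈ Icc s t → ∀ v, HasDerivAt (fun u => N u b) v u →
      |v| ≤ ∑ f, lam f + capacity (μ b) := by
    filter_upwards [h.ae_hasDerivAt] with u hu hmem v hv
    have hu0 := hs.trans hmem.1
    obtain ⟨v', ⟨x, hx, hv'⟩, hd⟩ := hu hu0
    have hw : (fun b => ∑ f, lam f * x f b) ∈ inflows E lam := ⟨x, fun f => (hx f).1, fun _ => rfl⟩
    have h1 := nonneg_of_mem_inflows hlam hw b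
    have h2 := le_of_mem_inflows hlam hw b
    have h3 := (hμ b).nonneg (h.nonneg u hu0 b)
    have h4 := (hμ b).le_capacity (h.nonneg u hu0 b)
    rw [hv.unique (hd b), hv', abs_le]
    constructor <;> linarith
  have h1 := sub_le_integral_of_hasDerivAt_le (φ := fun _ => ∑ f, lam f + capacity (μ b)) hst hac
    (by simp) (by filter_upwards [hd] with u hu hm v hv using (abs_le.1 (hu hm v hv)).2)
  have h2 := integral_le_sub_of_le_hasDerivAt (φ := fun _ => -(∑ f, lam f + capacity (μ b))) hst hac
    (by simp) (by filter_upwards [hd] with u hu hm v hv using (abs_le.1 (hu hm v hv)).1)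
  simp only [intervalIntegral.integral_const, smul_eq_mul] at h1 h2
  rw [abs_le]
  constructor <;> linarith

/-- Along a trajectory, the service rate of each backend converges. -/
theorem exists_tendsto_rate (hlam : ∀ f, 0 ≤ lam f) (hμ : ∀ b, IsServiceRate (μ b))
    (h : IsGMSRTrajectory E lam μ N) (b : B) :
    ∃ l, Tendsto (fun t => μ b (N t b)) atTop (𝓝 l) := by
  have hΛ : 0 ≤ ∑ f, lam f := Finset.sum_nonneg fun f _ => hlam f
  have hcap : 0 ≤ capacity (μ b) := ((hμ b).nonneg le_rfl).trans ((hμ b).le_capacity le_rfl)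
  have hp := (hμ b).marginalRate_nonneg 0
  refine exists_tendsto_of_integral_shift_le
    (K := marginalRate (μ b) 0 * (∑ f, lam f + capacity (μ b))) (by positivity)
    (fun s t hs hst => ?_) (h.continuousOn_rate hμ b) fun s hs => ?_
  · refine ((hμ b).abs_sub_le (h.nonneg s hs b) (h.nonneg t (hs.trans hst) b)).trans ?_
    rw [mul_assoc]
    exact mul_le_mul_of_nonneg_left (h.abs_sub_le hlam hμ b hs hst) hp
  -- The controlling function is the distance between the trajectory and its shift by `s`.
  · exact ⟨fun t => ∑ b, |N (t + s) b - N t b|, fun t => Finset.sum_nonneg fun _ _ => abs_nonneg _,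
      fun r t hr hrt => abs_integral_rate_sub_le hlam hμ (h.shift hs.le) h b hr hrt⟩

/-- The limit of a service rate along one trajectory is at most its limit along any other. -/
theorem limit_rate_le (hlam : ∀ f, 0 ≤ lam f) (hμ : ∀ b, IsServiceRate (μ b))
    (hN : IsGMSRTrajectory E lam μ N) (hM : IsGMSRTrajectory E lam μ M) {b : B} {l l' : ℝ}
    (hl : Tendsto (fun t => μ b (N t b)) atTop (𝓝 l))
    (hl' : Tendsto (fun t => μ b (M t b)) atTop (𝓝 l')) : l ≤ l' := by
  by_contra! hlt
  set δ := (l - l') / 2 with hδ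
  have hpos : 0 < δ := by linarith
  have hev : ∀ᶠ t in atTop, δ ≤ μ b (N t b) - μ b (M t b) :=
    ((hl.sub hl').eventually (lt_mem_nhds (by linarith : δ < l - l'))).mono fun _ => le_of_lt
  obtain ⟨T, hT⟩ := eventually_atTop.1 (hev.and (eventually_ge_atTop 0))
  have hT0 : 0 ≤ T := (hT T le_rfl).2
  set D := ∑ b, |N T b - M T b|
  have hD : 0 ≤ D := Finset.sum_nonneg fun _ _ => abs_nonneg _
  -- A gap of `δ` over this time integrates to `D + 1`, more than the distance `D` available.
  set t := T + (D + 1) / δ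
  have htT : T ≤ t := le_add_of_nonneg_right (by positivity)
  have h1 := abs_integral_rate_sub_le hlam hμ hN hM b hT0 htT
  have h2 : ∫ _ in T..t, δ ≤ ∫ u in T..t, (μ b (N u b) - μ b (M u b)) :=
    intervalIntegral.integral_mono_on htT (by simp)
      ((hN.intervalIntegrable_rate hμ b hT0 (hT0.trans htT)).sub
        (hM.intervalIntegrable_rate hμ b hT0 (hT0.trans htT))) fun u hu => (hT u hu.1).1
  have h3 : (t - T) * δ = D + 1 := by
    simp only [t, add_sub_cancel_left]
    field_simp
  rw [intervalIntegral.integral_const, smul_eq_mul, h3] at h2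
  have h4 : 0 ≤ ∑ b, |N t b - M t b| := Finset.sum_nonneg fun _ _ => abs_nonneg _
  have h5 := le_abs_self (∫ u in T..t, (μ b (N u b) - μ b (M u b)))
  linarith

end IsGMSRTrajectory

end LoadBalancing

/-! ### The linear program: attainment and the cut bound -/

namespace LoadBalancing

variable {F B : Type*} [Fintype F] [Fintype B] {E : F → B → Prop} {lam : F → ℝ}
  {μ : B → ℝ → ℝ}

/-- The throughput-maximization linear program has an optimal solution. -/
theorem exists_isTPOptimal (hF : ∀ f, ∃ b, E f b) (lam : F → ℝ) (μ : B → ℝ → ℝ) :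
    ∃ L, IsTPOptimal E lam μ L := by
  -- For fixed inflows the best service rates are their minima with the capacities, so only `w` has
  -- to be optimized.
  obtain ⟨w, ⟨x, hx, hw⟩, hmax⟩ := (isCompact_inflows E lam).exists_isMaxOn
    (inflows_nonempty hF lam) (f := fun w => ∑ b, min (w b) (capacity (μ b))) (by fun_prop)
  refine ⟨fun b => min (w b) (capacity (μ b)), x,
    ⟨fun b => (min_le_left _ _).trans (hw b).le, fun b => min_le_right _ _, hx⟩, fun L' x' h => ?_⟩
  have hw' : (fun b => ∑ f, lam f * x' f b) ∈ inflows E lam := ⟨x', h.routing, fun _ => rfl⟩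
  exact (Finset.sum_le_sum fun b _ => le_min (h.le_inflow b) (h.le_capacity b)).trans (hmax hw')

/-- A vector that is dominated by inflows up to any error is dominated by inflows. -/
theorem exists_mem_inflows_ge {L : B → ℝ}
    (h : ∀ ε, 0 < ε → ∃ w ∈ inflows E lam, ∀ b, L b - ε ≤ w b) :
    ∃ w ∈ inflows E lam, ∀ b, L b ≤ w b := by
  choose w hw hLw using fun n : ℕ => h (1 / ((n : ℝ) + 1)) (by positivity)
  obtain ⟨v, hv, φ, hφ, hlim⟩ := (isCompact_inflows E lam).tendsto_subseq hw
  refine ⟨v, hv, fun b => ?_⟩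
  have h1 : Tendsto (fun n => L b - 1 / ((φ n : ℝ) + 1)) atTop (𝓝 (L b - 0)) :=
    tendsto_const_nhds.sub (tendsto_one_div_add_atTop_nhds_zero_nat.comp hφ.tendsto_atTop)
  rw [sub_zero] at h1
  exact le_of_tendsto_of_tendsto' h1 (tendsto_pi_nhds.1 hlim b) fun n => hLw (φ n) b

/-- The upper bound on the throughput given by the cut that separates a set `S` of backends, and
the frontends adjacent to it, from the rest. -/
theorem IsTPFeasible.sum_le {L : B → ℝ} {x : F → B → ℝ} (h : IsTPFeasible E lam μ L x)
    (hlam : ∀ f, 0 ≤ lam f) (S : Finset B) [DecidablePred fun f => ∃ b ∈ S, E f b] :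
    ∑ b ∈ S, L b ≤ ∑ f with ∃ b ∈ S, E f b, lam f := by
  refine (Finset.sum_le_sum fun b _ => h.le_inflow b).trans ?_
  rw [Finset.sum_comm, Finset.sum_filter]
  refine Finset.sum_le_sum fun f _ => ?_
  rw [← Finset.mul_sum]
  split_ifs with hf
  · refine mul_le_of_le_one_right (hlam f) ?_
    rw [← (h.routing f).1]
    exact Finset.sum_le_univ_sum_of_nonneg (h.routing f).nonneg
  · rw [Finset.sum_eq_zero fun b hb => (h.routing f).2.2 b fun hE => hf ⟨b, hb, hE⟩, mul_zero]

/-! ### Optimality of the limiting service rates -/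

namespace IsGMSRTrajectory

variable {N : ℝ → B → ℝ} {L : B → ℝ}

/-- The witness is the average inflow over a long window: mean service plus the net workload change
divided by the window length. Nonnegative workloads make that change at least minus the starting
workload. -/
theorem exists_mem_inflows_average_ge (hμ : ∀ b, IsServiceRate (μ b))
    (h : IsGMSRTrajectory E lam μ N) (hL : ∀ b, Tendsto (fun t => μ b (N t b)) atTop (𝓝 (L b)))
    {ε : ℝ} (hε : 0 < ε) : ∃ w ∈ inflows E lam, ∀ b, L b - ε ≤ w b := by
  have hev : ∀ᶠ t in atTop, ∀ b, L b - ε / 2 ≤ μ b (N t b) := eventually_all.2 fun b =>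
    ((hL b).eventually (lt_mem_nhds (by linarith : L b - ε / 2 < L b))).mono fun _ => le_of_lt
  obtain ⟨s, hs⟩ := eventually_atTop.1 (hev.and (eventually_ge_atTop 0))
  have hs0 : 0 ≤ s := (hs s le_rfl).2
  have hsum : 0 ≤ ∑ b, N s b := Finset.sum_nonneg fun b _ => h.nonneg s hs0 b
  -- Long enough that the starting workload divided by `τ` is below `ε / 2`; the other `ε / 2` comes
  -- from the service rates.
  set τ := 2 * (∑ b, N s b + 1) / ε with hτ
  have hτ0 : 0 < τ := by positivity
  have ht0 : 0 ≤ s + τ := by positivity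
  have hst : s ≤ s + τ := by linarith
  have hac := fun b => h.absolutelyContinuousOnInterval_apply hs0 ht0 b
  -- This recovers the inflow almost everywhere without a measurable selection of routing decisions.
  set v : ℝ → B → ℝ := fun t b => deriv (fun u => N u b) t + μ b (N t b)
  have hint : ∀ b, IntervalIntegrable (fun t => v t b) volume s (s + τ) := fun b =>
    (hac b).intervalIntegrable_deriv.add (h.intervalIntegrable_rate hμ b hs0 ht0)
  have hintOn : ∀ b, IntegrableOn (fun t => v t b) (Ioc s (s + τ)) := fun b =>
    (intervalIntegrable_iff_integrableOn_Ioc_of_le hst).1 (hint b)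
  have hvol : volume (Ioc s (s + τ)) = ENNReal.ofReal τ := by simp
  refine ⟨⨍ t in Ioc s (s + τ), v t, (convex_inflows E lam).set_average_mem
    (isCompact_inflows E lam).isClosed (by simp [hvol, hτ0]) (by simp [hvol]) ?_
    (Integrable.of_eval hintOn), fun b => ?_⟩
  · rw [ae_restrict_iff' measurableSet_Ioc]
    filter_upwards [h.ae_hasDerivAt] with t ht htm
    obtain ⟨v', ⟨x, hx, hv'⟩, hd⟩ := ht (hs0.trans htm.1.le)
    refine ⟨x, fun f => (hx f).1, fun b => ?_⟩
    simp only [v, (hd b).deriv, hv', sub_add_cancel]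
  · rw [setAverage_eq, Pi.smul_apply, eval_integral hintOn,
      ← intervalIntegral.integral_of_le hst, measureReal_def, hvol,
      ENNReal.toReal_ofReal hτ0.le, smul_eq_mul,
      intervalIntegral.integral_add (hac b).intervalIntegrable_deriv
        (h.intervalIntegrable_rate hμ b hs0 ht0), (hac b).integral_deriv_eq_sub]
    have h1 : ∫ _ in s..s + τ, (L b - ε / 2) ≤ ∫ u in s..s + τ, μ b (N u b) :=
      intervalIntegral.integral_mono_on hst (by simp) (h.intervalIntegrable_rate hμ b hs0 ht0)
        fun u hu => (hs u hu.1).1 b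
    rw [intervalIntegral.integral_const, smul_eq_mul, add_sub_cancel_left] at h1
    have h2 : N s b ≤ ∑ b, N s b :=
      Finset.single_le_sum (fun c _ => h.nonneg s hs0 c) (Finset.mem_univ b)
    have h3 : τ * ε = 2 * (∑ b, N s b + 1) := by
      rw [hτ]
      field_simp
    have h4 := h.nonneg _ ht0 b
    rw [inv_mul_eq_div, le_div_iff₀ hτ0]
    linarith

theorem limit_le_capacity (hμ : ∀ b, IsServiceRate (μ b)) (h : IsGMSRTrajectory E lam μ N) {b : B}
    {l : ℝ} (hl : Tendsto (fun t => μ b (N t b)) atTop (𝓝 l)) : l ≤ capacity (μ b) := by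
  refine le_of_tendsto hl ?_
  filter_upwards [eventually_ge_atTop 0] with t ht
  exact (hμ b).le_capacity (h.nonneg t ht b)

/-- The limiting service rates are feasible for the throughput-maximization linear program. -/
theorem exists_isTPFeasible (hμ : ∀ b, IsServiceRate (μ b)) (h : IsGMSRTrajectory E lam μ N)
    (hL : ∀ b, Tendsto (fun t => μ b (N t b)) atTop (𝓝 (L b))) :
    ∃ x, IsTPFeasible E lam μ L x := by
  obtain ⟨w, ⟨x, hx, hw⟩, hLw⟩ :=
    exists_mem_inflows_ge fun _ hε => h.exists_mem_inflows_average_ge hμ hL hε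
  exact ⟨x, fun b => (hLw b).trans (hw b).le, fun b => h.limit_le_capacity hμ (hL b), hx⟩

/-- The marginal rate of a backend whose service rate tends to its capacity vanishes. -/
theorem tendsto_marginalRate (hμ : ∀ b, IsServiceRate (μ b)) (h : IsGMSRTrajectory E lam μ N)
    {b : B} (hb : Tendsto (fun t => μ b (N t b)) atTop (𝓝 (capacity (μ b)))) :
    Tendsto (fun t => marginalRate (μ b) (N t b)) atTop (𝓝 0) := by
  refine (hμ b).tendsto_marginalRate.comp (tendsto_atTop.2 fun R => ?_)
  filter_upwards [hb.eventually (lt_mem_nhds ((hμ b).lt_capacity (le_max_right R 0))),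
    eventually_ge_atTop 0] with t h1 h2
  exact (le_max_left R 0).trans
    (((hμ b).strictMonoOn.lt_iff_lt (le_max_right R 0) (h.nonneg t h2 b)).1 h1).le

/-- The workload of a backend whose service rate stays away from its capacity is bounded. -/
theorem eventually_le (hμ : ∀ b, IsServiceRate (μ b)) (h : IsGMSRTrajectory E lam μ N)
    {b : B} {l : ℝ} (hb : Tendsto (fun t => μ b (N t b)) atTop (𝓝 l)) (hl : l < capacity (μ b)) :
    ∃ R, 0 ≤ R ∧ ∀ᶠ t in atTop, N t b ≤ R := by
  obtain ⟨R, hR, hR0⟩ := (((hμ b).tendsto_capacity.eventually (lt_mem_nhds hl)).and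
    (eventually_ge_atTop 0)).exists
  refine ⟨R, hR0, ?_⟩
  filter_upwards [hb.eventually (gt_mem_nhds hR), eventually_ge_atTop 0] with t h1 h2
  exact (((hμ b).strictMonoOn.lt_iff_lt (h.nonneg t h2 b) hR0).1 h1).le

/-- The backends that are not saturated in the limit serve all the arrivals at the frontends
adjacent to them. -/
theorem sum_lam_le (hμ : ∀ b, IsServiceRate (μ b))
    (h : IsGMSRTrajectory E lam μ N) (hL : ∀ b, Tendsto (fun t => μ b (N t b)) atTop (𝓝 (L b)))
    (hlam : ∀ f, 0 ≤ lam f) (S : Finset B) [DecidablePred fun f => ∃ b ∈ S, E f b]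
    (hS : ∀ b, b ∈ S ↔ L b < capacity (μ b)) :
    ∑ f with ∃ b ∈ S, E f b, lam f ≤ ∑ b ∈ S, L b := by
  by_contra! hlt
  set Λ := ∑ f with ∃ b ∈ S, E f b, lam f with hΛ
  set δ := (Λ - ∑ b ∈ S, L b) / 2 with hδ
  have hδ0 : 0 < δ := by linarith
  choose! R hR0 hR using fun b (hb : b ∈ S) => h.eventually_le hμ (hL b) ((hS b).1 hb)
  have hev1 : ∀ᶠ t in atTop, ∀ b ∈ S, N t b ≤ R b := (Finset.eventually_all S).2 hR
  have hev2 : ∀ᶠ t in atTop, ∀ b ∈ S, ∀ c, c ∉ S →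
      marginalRate (μ c) (N t c) < marginalRate (μ b) (N t b) := by
    refine (Finset.eventually_all S).2 fun b hb => eventually_all.2 fun c => ?_
    by_cases hc : c ∈ S
    · simp [hc]
    have hcap : L c = capacity (μ c) :=
      (h.limit_le_capacity hμ (hL c)).antisymm (not_lt.1 fun hlt => hc ((hS c).2 hlt))
    have hzero := h.tendsto_marginalRate hμ (hcap ▸ hL c)
    filter_upwards [hR b hb, eventually_ge_atTop 0,
      hzero.eventually (gt_mem_nhds ((hμ b).marginalRate_pos (hR0 b hb)))] with t h1 h2 h3 _
    exact h3.trans_le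
      ((hμ b).strictAntiOn_marginalRate.antitoneOn (h.nonneg t h2 b) (hR0 b hb) h1)
  have hev3 : ∀ᶠ t in atTop, ∑ b ∈ S, μ b (N t b) < Λ - δ :=
    (tendsto_finsetSum S fun b _ => hL b).eventually (gt_mem_nhds (by linarith))
  obtain ⟨s, hs⟩ := eventually_atTop.1
    (((hev1.and hev2).and hev3).and (eventually_ge_atTop 0))
  have hs0 : 0 ≤ s := (hs s le_rfl).2
  have hRsum : 0 ≤ ∑ b ∈ S, R b := Finset.sum_nonneg hR0
  -- Growth at rate `δ` for this long pushes the total workload of `S` above its bound `∑ b ∈ S, R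
  -- b`.
  set t := s + (∑ b ∈ S, R b + 1) / δ with ht
  have hst : s ≤ t := le_add_of_nonneg_right (by positivity)
  have h1 := integral_le_sub_of_le_hasDerivAt (f := fun u => ∑ b ∈ S, N u b) (φ := fun _ => δ) hst
    (absolutelyContinuousOnInterval_sum _ fun b _ =>
      h.absolutelyContinuousOnInterval_apply hs0 (hs0.trans hst) b) (by simp) (by
    filter_upwards [h.ae_hasDerivAt] with u hu hmem w hw
    obtain ⟨⟨⟨-, hlt⟩, hrate⟩, hu0⟩ := hs u hmem.1
    obtain ⟨v, ⟨x, hx, hv⟩, hd⟩ := hu hu0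
    rw [hw.unique (HasDerivAt.fun_sum fun b _ => hd b)]
    simp_rw [hv, Finset.sum_sub_distrib]
    rw [Finset.sum_comm]
    have hle : Λ ≤ ∑ f, ∑ b ∈ S, lam f * x f b := by
      rw [hΛ, Finset.sum_filter]
      refine Finset.sum_le_sum fun f _ => ?_
      rw [← Finset.mul_sum]
      split_ifs with hf
      · obtain ⟨b, hb, hE⟩ := hf
        have hone : ∑ c ∈ S, x f c = 1 := by
          rw [← (hx f).1.1]
          refine Finset.sum_subset (Finset.subset_univ S) fun c _ hc => ?_
          refine (le_of_not_gt fun hpos => ?_).antisymm ((hx f).1.nonneg c)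
          exact (marginalRate_le_of_mem_gmsrRouting (hx f) hpos hE).not_gt (hlt b hb c hc)
        rw [hone, mul_one]
      · exact mul_nonneg (hlam f) (Finset.sum_nonneg fun b _ => (hx f).1.nonneg b)
    linarith)
  rw [intervalIntegral.integral_const, smul_eq_mul, ht, add_sub_cancel_left,
    div_mul_cancel₀ _ hδ0.ne', ← ht] at h1
  have h2 : ∑ b ∈ S, N t b ≤ ∑ b ∈ S, R b := Finset.sum_le_sum (hs t hst).1.1.1
  have h3 : 0 ≤ ∑ b ∈ S, N s b := Finset.sum_nonneg fun b _ => h.nonneg s hs0 b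
  linarith

/-- The limiting service rates are optimal for the throughput-maximization linear program. -/
theorem isTPOptimal (hlam : ∀ f, 0 ≤ lam f) (hμ : ∀ b, IsServiceRate (μ b))
    (h : IsGMSRTrajectory E lam μ N)
    (hL : ∀ b, Tendsto (fun t => μ b (N t b)) atTop (𝓝 (L b))) : IsTPOptimal E lam μ L := by
  classical
  obtain ⟨x, hx⟩ := h.exists_isTPFeasible hμ hL
  refine ⟨x, hx, fun L' x' hx' => ?_⟩
  -- On `S` the cut bound is attained; off `S` the capacity bound is.
  set S := Finset.univ.filter fun b => L b < capacity (μ b)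
  rw [← Finset.sum_add_sum_compl S L', ← Finset.sum_add_sum_compl S L]
  refine add_le_add ((hx'.sum_le hlam S).trans (h.sum_lam_le hμ hL hlam S (by simp [S])))
    (Finset.sum_le_sum fun b hb => (hx'.le_capacity b).trans ?_)
  simpa [S] using hb

end IsGMSRTrajectory

end LoadBalancing

theorem mainTheorem5 {F B : Type*} [Fintype F] [Fintype B]
    (E : F → B → Prop)
    (hF : ∀ f, ∃ b, E f b) (hB : ∀ b, ∃ f, E f b)
    (lam : F → ℝ) (hlam : ∀ f, 0 ≤ lam f)
    (μ : B → ℝ → ℝ) (hμ : ∀ b, LoadBalancing.IsServiceRate (μ b)) :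
    ∃ L : B → ℝ, LoadBalancing.IsTPOptimal E lam μ L ∧
      ∀ N : ℝ → B → ℝ, LoadBalancing.IsGMSRTrajectory E lam μ N →
        ∀ b, Filter.Tendsto (fun t => μ b (N t b)) Filter.atTop (nhds (L b)) := by
  -- Existence of trajectories is not needed: without any, every optimal solution of the program
  -- serves.
  by_cases h : ∃ N, LoadBalancing.IsGMSRTrajectory E lam μ N
  · obtain ⟨N, hN⟩ := h
    choose L hL using hN.exists_tendsto_rate hlam hμ
    refine ⟨L, hN.isTPOptimal hlam hμ hL, fun M hM b => ?_⟩
    obtain ⟨l, hl⟩ := hM.exists_tendsto_rate hlam hμ b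
    rwa [(hN.limit_rate_le hlam hμ hM (hL b) hl).antisymm
      (hM.limit_rate_le hlam hμ hN hl (hL b))]
  · obtain ⟨L, hL⟩ := LoadBalancing.exists_isTPOptimal hF lam μ
    exact ⟨L, hL, fun N hN => absurd ⟨N, hN⟩ h⟩
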